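/- Let $K$ be a locally compact Hausdorff hypergroup. That is, to all $x,y\in K$ there is assigned a regular Borel probability measure $\delta_x*\delta_y$ with compact support such that $(x,y)\mapsto\delta_x*\delta_y$ is weakly continuous; $(x,y)\mapsto\operatorname{supp}(\delta_x*\delta_y)$ is continuous for the Michael (Vietoris) topology on compact sets; the convolution is associative, i.e. $(\delta_x*\delta_y)*\delta_z=\delta_x*(\delta_y*\delta_z)$ for the extension $\int f\,d(\mu*\nu)=\int\!\int f(x*y)\,d\mu(x)\,d\nu(y)$ to bounded regular measures, where $f(x*y)=\int_K f\,d(\delta_x*\delta_y)$; there is an identity $e$ with $\delta_e*\delta_x=\delta_x*\delta_e=\delta_x$; and there is a continuous involution $x\mapsto\check x$ of $K$ such that the image of $\delta_x*\delta_y$ under it is $\delta_{\check y}*\delta_{\check x}$, and $e\in\operatorname{supp}(\delta_x*\delta_y)$ if and only if $x=\check y$. Let $\sigma$ be a regular Borel probability measure on $K$ that is non-degenerate, i.e. $K=\overline{\bigcup_{n\ge1}(\operatorname{supp}\sigma)^n}$, where $A*B=\bigcup_{a\in A,\,b\in B}\operatorname{supp}(\delta_a*\delta_b)$ for $A,B\subseteq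 K$ and $A^n$ is the $n$-fold product. Let $f:K\to\mathbb C$ be a continuous function vanishing at infinity (hence bounded) which is $\sigma$-harmonic, i.e. $\sigma*f=f$, where $$(\sigma*f)(x)=\int_K f(\check y*x)\,d\sigma(y)\qquad(x\in K).$$ Then $f$ is constant. In particular, $f=0$ if $K$ is non-compact. -/

import Mathlib

open MeasureTheory Set Topology
open scoped ZeroAtInfty

/-- A hypergroup structure on a (locally compact Hausdorff) space `K`, given by the convolutions
`conv x y = δ_x * δ_y` of point masses. The convolution of bounded regular measures is the unique
weakly continuous bilinear extension `∫ f d(μ * ν) = ∫∫ f(x * y) dμ(x) dν(y)`, where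
`f(x * y) = ∫ f d(δ_x * δ_y)`. -/
class Hypergroup (K : Type*) [TopologicalSpace K] [MeasurableSpace K] [BorelSpace K] where
  /-- `conv x y` is the probability measure `δ_x * δ_y`. -/
  conv : K → K → ProbabilityMeasure K
  /-- The identity element `e`. -/
  one : K
  /-- The involution `x ↦ x̌`. -/
  invol : K → K
  regular_conv : ∀ x y, (conv x y : Measure K).Regular
  isCompact_support_conv : ∀ x y, IsCompact (conv x y : Measure K).support
  /-- The map `(x, y) ↦ δ_x * δ_y` is continuous for the weak topology. -/
  continuous_conv : Continuous fun p : K × K => conv p.1 p.2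
  /-- The map `(x, y) ↦ supp (δ_x * δ_y)` is continuous for the Michael (Vietoris) topology; the
  topology of the space of non-empty compact sets is the one induced from
  `TopologicalSpace.vietoris K`. -/
  continuous_support_conv :
    Continuous[inferInstance, TopologicalSpace.vietoris K]
      fun p : K × K => (conv p.1 p.2 : Measure K).support
  /-- `(δ_x * δ_y) * δ_z = δ_x * (δ_y * δ_z)`, as functionals on `C₀(K)`. -/
  conv_assoc : ∀ (x y z : K) (f : C₀(K, ℂ)),
    ∫ t, (∫ s, f s ∂(conv t z : Measure K)) ∂(conv x y : Measure K) =
      ∫ t, (∫ s, f s ∂(conv x t : Measure K)) ∂(conv y z : Measure K)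
  one_conv : ∀ x, (conv one x : Measure K) = Measure.dirac x
  conv_one : ∀ x, (conv x one : Measure K) = Measure.dirac x
  continuous_invol : Continuous invol
  invol_invol : ∀ x, invol (invol x) = x
  /-- `(δ_x * δ_y)ˇ = δ_y̌ * δ_x̌`, where `μ̌` is the image of `μ` under the involution. -/
  map_invol_conv : ∀ x y,
    Measure.map invol (conv x y : Measure K) = (conv (invol y) (invol x) : Measure K)
  one_mem_support_conv_iff : ∀ x y,
    one ∈ (conv x y : Measure K).support ↔ x = invol y

namespace Hypergroup

variable {K : Type*} [TopologicalSpace K] [MeasurableSpace K] [BorelSpace K] [Hypergroup K]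

/-- `f(x * y) = ∫ f d(δ_x * δ_y)`. -/
noncomputable def evalConv (f : K → ℂ) (x y : K) : ℂ :=
  ∫ t, f t ∂(conv x y : Measure K)

/-- The convolution of a measure and a function, `(σ * f)(x) = ∫ f(y̌ * x) dσ(y)`. -/
noncomputable def convFun (σ : Measure K) (f : K → ℂ) (x : K) : ℂ :=
  ∫ y, evalConv f (invol y) x ∂σ

/-- `f` is `σ`-harmonic if `σ * f = f`. -/
def IsHarmonic (σ : Measure K) (f : K → ℂ) : Prop :=
  convFun σ f = f

/-- The product `A * B = ⋃_{a ∈ A, b ∈ B} supp (δ_a * δ_b)` of subsets of a hypergroup. -/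
def setMul (A B : Set K) : Set K :=
  ⋃ a ∈ A, ⋃ b ∈ B, (conv a b : Measure K).support

/-- The powers of a subset of a hypergroup: `A⁰ = {e}` and `Aⁿ⁺¹ = Aⁿ * A`. -/
def setPow (A : Set K) : ℕ → Set K
  | 0 => {one}
  | n + 1 => setMul (setPow A n) A

/-- A positive measure `σ` is non-degenerate if `⋃_{n ≥ 1} (supp σ)ⁿ` is dense in `K`. -/
def IsNondegenerate (σ : Measure K) : Prop :=
  closure (⋃ n : ℕ, ⋃ _ : 1 ≤ n, setPow σ.support n) = univ

end Hypergroup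

/-!
The proof is a maximum principle. If `f ≠ 0`, then `‖f‖` attains its maximum at some point `x₀`, as
`f` vanishes at infinity; put `c = f x₀` and `E = {f = c}`. Since `ℂ` is strictly convex, an average
of values of norm at most `‖c‖` equals `c` only if almost all of the values equal `c`
(`ae_eq_const_of_integral_eq`), and by continuity `f = c` then holds on the support.

Let `P = constSet f c` be the set of all `y` such that `f(y̌ * x) = c` for all `x ∈ E`. It is closed,
contains `e`, contains `supp σ` by harmonicity, and is stable under the product of sets by
associativity (`setMul_subset_constSet`). Non-degeneracy of `σ` gives `P = K`. Now
`f(x̌₀ * x₀) = c` and `e ∈ supp (δ_x̌₀ * δ_x₀)` show that `e ∈ E`, and then `f(y) = f(y * e) = c` for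
all `y ∈ K`.
-/

namespace Hypergroup

/-- Strict convexity of `ℂ`: the mean of a function bounded in norm by `‖c‖` is `c` only if the
function is almost everywhere equal to `c`. -/
lemma ae_eq_const_of_integral_eq {α : Type*} [MeasurableSpace α] {μ : Measure α}
    [IsProbabilityMeasure μ] {g : α → ℂ} {c : ℂ} (hg : ∀ x, ‖g x‖ ≤ ‖c‖)
    (h : ∫ x, g x ∂μ = c) : ∀ᵐ x ∂μ, g x = c := by
  rcases ae_eq_const_or_norm_integral_lt_of_norm_le_const (μ := μ) (.of_forall hg) with h1 | h1
  · rw [average_eq_integral, h] at h1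
    exact h1
  · simp [h] at h1

lemma eq_of_mem_support_of_ae_eq {X : Type*} [TopologicalSpace X] [MeasurableSpace X]
    {μ : Measure X} {g : X → ℂ} (hg : Continuous g) {c : ℂ}
    (h : ∀ᵐ x ∂μ, g x = c) {x : X} (hx : x ∈ μ.support) : g x = c :=
  Measure.support_subset_of_isClosed (isClosed_eq hg continuous_const) h hx

variable {K : Type*} [TopologicalSpace K] [MeasurableSpace K] [BorelSpace K] [Hypergroup K]

lemma continuous_evalConv (f : C₀(K, ℂ)) :
    Continuous fun p : K × K => evalConv f p.1 p.2 := by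
  have h : Continuous fun μ : ProbabilityMeasure K => ∫ t, f t ∂(μ : Measure K) := by
    -- Weak convergence is tested on real functions, hence on real and imaginary parts.
    have hre (g : BoundedContinuousFunction K ℝ) :
        Continuous fun μ : ProbabilityMeasure K => ∫ t, g t ∂(μ : Measure K) :=
      continuous_iff_continuousAt.2 fun μ =>
        (ProbabilityMeasure.tendsto_iff_forall_integral_tendsto.1 Filter.tendsto_id) g
    have hf (μ : ProbabilityMeasure K) : Integrable f (μ : Measure K) :=
      f.toBCF.integrable _
    have key : (fun μ : ProbabilityMeasure K => ∫ t, f t ∂(μ : Measure K)) =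
        fun μ : ProbabilityMeasure K =>
        ((∫ t, f.toBCF.comp _ Complex.reCLM.lipschitz t ∂(μ : Measure K) : ℝ) : ℂ) +
          ((∫ t, f.toBCF.comp _ Complex.imCLM.lipschitz t ∂(μ : Measure K) : ℝ) : ℂ) *
            Complex.I := by
      funext μ
      exact (integral_re_add_im (𝕜 := ℂ) (hf μ)).symm
    rw [key]
    exact (Complex.continuous_ofReal.comp (hre _)).add
      ((Complex.continuous_ofReal.comp (hre _)).mul continuous_const)
  exact h.comp continuous_conv

lemma continuous_evalConv_invol (f : C₀(K, ℂ)) (x : K) :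
    Continuous fun y => evalConv f (invol y) x :=
  (continuous_evalConv f).comp (continuous_invol.prodMk continuous_const)

lemma norm_evalConv_le {f : K → ℂ} {M : ℝ} (hM : ∀ x, ‖f x‖ ≤ M) (x y : K) :
    ‖evalConv f x y‖ ≤ M := by
  simpa [evalConv] using
    norm_integral_le_of_norm_le_const (μ := (conv x y : Measure K)) (.of_forall hM)

lemma evalConv_one_left (f : C₀(K, ℂ)) (x : K) : evalConv f one x = f x := by
  rw [evalConv, one_conv]
  exact integral_dirac' _ _ (map_continuous f).stronglyMeasurable

lemma evalConv_one_right (f : C₀(K, ℂ)) (x : K) : evalConv f x one = f x := by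
  rw [evalConv, conv_one]
  exact integral_dirac' _ _ (map_continuous f).stronglyMeasurable

variable (K) in
lemma invol_one : invol (one : K) = one := by
  refine ((one_mem_support_conv_iff (one : K) one).1 ?_).symm
  rw [one_conv, Measure.mem_support_iff_forall]
  intro U hU
  exact lt_of_lt_of_le (by simp [mem_of_mem_nhds hU]) Measure.le_dirac_apply

/-- The points `y` such that `f(y̌ * x) = c` for all `x` in the level set `{f = c}`. If `‖f‖ ≤ ‖c‖`,
these are the `y` for which `{f = c}` is stable under left multiplication by `y̌`. -/
def constSet (f : K → ℂ) (c : ℂ) : Set K :=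
  {y | ∀ x, f x = c → evalConv f (invol y) x = c}

lemma isClosed_constSet (f : C₀(K, ℂ)) (c : ℂ) : IsClosed (constSet f c) := by
  simp only [constSet, ofPred_forall]
  exact isClosed_iInter fun x => isClosed_iInter fun _ =>
    isClosed_eq (continuous_evalConv_invol f x) continuous_const

lemma one_mem_constSet (f : C₀(K, ℂ)) (c : ℂ) : one ∈ constSet f c := fun x hx => by
  rw [invol_one, evalConv_one_left, hx]

lemma support_subset_constSet {σ : Measure K} [IsProbabilityMeasure σ] {f : C₀(K, ℂ)}
    (hf : IsHarmonic σ f) {c : ℂ} (hc : ∀ x, ‖f x‖ ≤ ‖c‖) : σ.support ⊆ constSet f c := by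
  intro y hy x hx
  have h : ∫ y, evalConv f (invol y) x ∂σ = c := (congrFun hf x).trans hx
  exact eq_of_mem_support_of_ae_eq (continuous_evalConv_invol f x)
    (ae_eq_const_of_integral_eq (fun y => norm_evalConv_le hc _ _) h) hy

/-- For `a, b ∈ constSet f c` and `f(x) = c`, associativity equates the mean of `f(š * x)` over
`s ∈ supp (δ_a * δ_b)` with the mean of `f(b̌ * t)` over `t ∈ supp (δ_ǎ * δ_x)`, and the latter
is `c`. -/
lemma setMul_subset_constSet {f : C₀(K, ℂ)} {c : ℂ} (hc : ∀ x, ‖f x‖ ≤ ‖c‖) {A B : Set K}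
    (hA : A ⊆ constSet f c) (hB : B ⊆ constSet f c) : setMul A B ⊆ constSet f c := by
  intro z hz x hx
  simp only [setMul, mem_iUnion] at hz
  obtain ⟨a, ha, b, hb, hz⟩ := hz
  have h1 : ∀ᵐ t ∂(conv (invol a) x : Measure K), f t = c :=
    ae_eq_const_of_integral_eq hc (hA ha x hx)
  have h2 : ∫ t, evalConv f (invol b) t ∂(conv (invol a) x : Measure K) = c := by
    have : ∀ᵐ t ∂(conv (invol a) x : Measure K), evalConv f (invol b) t = c :=
      h1.mono fun t ht => hB hb t ht
    simp [integral_congr_ae this]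
  have h3 : ∫ s, evalConv f (invol s) x ∂(conv a b : Measure K) = c := by
    have hcont : Continuous fun t => evalConv f t x :=
      (continuous_evalConv f).comp (continuous_id.prodMk continuous_const)
    rw [← h2, ← integral_map (f := fun t => evalConv f t x)
      continuous_invol.measurable.aemeasurable hcont.aestronglyMeasurable, map_invol_conv]
    exact conv_assoc (invol b) (invol a) x f
  exact eq_of_mem_support_of_ae_eq (continuous_evalConv_invol f x)
    (ae_eq_const_of_integral_eq (fun y => norm_evalConv_le hc _ _) h3) hz

lemma constSet_eq_univ {σ : Measure K} [IsProbabilityMeasure σ] (hσ : IsNondegenerate σ)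
    {f : C₀(K, ℂ)} (hf : IsHarmonic σ f) {c : ℂ} (hc : ∀ x, ‖f x‖ ≤ ‖c‖) :
    constSet f c = univ := by
  have hpow (n : ℕ) : setPow σ.support n ⊆ constSet f c := by
    induction n with
    | zero => exact singleton_subset_iff.2 (one_mem_constSet f c)
    | succ n ih => exact setMul_subset_constSet hc ih (support_subset_constSet hf hc)
  rw [← univ_subset_iff, ← hσ]
  exact closure_minimal (iUnion_subset fun n => iUnion_subset fun _ => hpow n)
    (isClosed_constSet f c)

/-- The maximum principle: a harmonic function whose norm attains its maximum is constant. -/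
lemma eq_of_forall_norm_le {σ : Measure K} [IsProbabilityMeasure σ] (hσ : IsNondegenerate σ)
    {f : C₀(K, ℂ)} (hf : IsHarmonic σ f) {x₀ : K} (hx₀ : ∀ x, ‖f x‖ ≤ ‖f x₀‖) (x : K) :
    f x = f x₀ := by
  have hP (y z : K) (hz : f z = f x₀) : evalConv f (invol y) z = f x₀ :=
    (constSet_eq_univ hσ hf hx₀ ▸ mem_univ y : y ∈ constSet f (f x₀)) z hz
  have hone : f one = f x₀ :=
    eq_of_mem_support_of_ae_eq (map_continuous f) (ae_eq_const_of_integral_eq hx₀ (hP x₀ x₀ rfl))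
      ((one_mem_support_conv_iff (invol x₀) x₀).2 rfl)
  simpa [invol_invol, evalConv_one_right] using hP (invol x) one hone

end Hypergroup

lemma ZeroAtInftyContinuousMap.exists_forall_norm_le {X : Type*} [TopologicalSpace X] [Nonempty X]
    (f : C₀(X, ℂ)) : ∃ x₀, ∀ x, ‖f x‖ ≤ ‖f x₀‖ := by
  by_cases h : ∃ x, f x ≠ 0
  · obtain ⟨x, hx⟩ := h
    have h0 : Filter.Tendsto (fun y => ‖f y‖) (Filter.cocompact X) (𝓝 0) := by
      simpa using (zero_at_infty f).norm
    exact (map_continuous f).norm.exists_forall_ge' x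
      ((h0.eventually_lt_const (norm_pos_iff.2 hx)).mono fun _ => le_of_lt)
  · push Not at h
    exact ⟨Classical.arbitrary X, fun x => by simp [h]⟩

theorem mainTheorem2 {K : Type*} [TopologicalSpace K] [LocallyCompactSpace K] [T2Space K]
    [MeasurableSpace K] [BorelSpace K] [Hypergroup K]
    (σ : Measure K) [IsProbabilityMeasure σ] [σ.Regular]
    (hσ : Hypergroup.IsNondegenerate σ)
    (f : C₀(K, ℂ)) (hf : Hypergroup.IsHarmonic σ f) :
    (∃ c : ℂ, ∀ x : K, f x = c) ∧ (NoncompactSpace K → ∀ x : K, f x = 0) := by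
  have : Nonempty K := ⟨Hypergroup.one⟩
  obtain ⟨x₀, hx₀⟩ := f.exists_forall_norm_le
  have h := Hypergroup.eq_of_forall_norm_le hσ hf hx₀
  refine ⟨⟨f x₀, h⟩, fun _ x => ?_⟩
  have h0 : Filter.Tendsto f (Filter.cocompact K) (𝓝 0) := zero_at_infty f
  rw [funext h] at h0
  rw [h x, tendsto_nhds_unique tendsto_const_nhds h0]
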